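/- For $n\ge 1$ let $C_n$ be the symmetry group of the $n$-cube, i.e. the finite group of all linear isometries of $\mathbb{R}^n$ that map the set $\{\pm e_1,\dots,\pm e_n\}$ onto itself, where $e_1,\dots,e_n$ is the standard orthonormal basis. Let $r_1\in C_n$ be the reflection with root $e_1$ (it inverts the first coordinate) and, for $n\ge 2$, let $r_{+1,1,2}\in C_n$ be the reflection with root $e_1-e_2$ (it permutes the first two coordinates). Let $\mathrm{End}(C_n)$ be the finite set of all group homomorphisms $C_n\to C_n$, and for $r\in C_n$ write $$\mathbb{P}_{\varphi\in\mathrm{End}(C_n)}\big[r\in\ker\varphi\big]=\frac{|\{\varphi\in\mathrm{End}(C_n): r\in\ker\varphi\}|}{|\mathrm{End}(C_n)|}$$ for the probability that $r$ lies in the kernel of a uniformly random endomorphism of $C_n$. (1) For every choice, for each $n$, of an element $r^{(n)}\in C_n$ that is conjugate in $C_n$ to $r_{+1,1,2}$ whenever $n\ge 2$, one has $\lim_{n\to\infty}\mathbb{P}_{\varphi\in\mathrm{End}(C_n)}[r^{(n)}\in\ker\varphi]=0$. (2) For every choice, for each $n\ge 1$, of an element $r^{(n)}\in C_n$ that is conjugate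 in $C_n$ to $r_1$, one has $\lim_{n\to\infty}\mathbb{P}_{\varphi\in\mathrm{End}(C_n)}[r^{(n)}\in\ker\varphi]=\tfrac14$. -/

import Mathlib

open Filter Topology

noncomputable section

/-- The set `{± e_1, …, ± e_n}` of signed standard basis vectors of Euclidean space `ℝⁿ`. -/
def signedBasis (n : ℕ) : Set (EuclideanSpace ℝ (Fin n)) :=
  {x | ∃ i, x = EuclideanSpace.single i (1 : ℝ) ∨ x = -EuclideanSpace.single i (1 : ℝ)}

/-- The group `C_n`, the symmetry group of the `n`-cube: the linear isometries of `ℝⁿ` that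
permute and invert the vectors of the standard orthonormal basis, that is, that map the set
`{± e_1, …, ± e_n}` onto itself. -/
def hyperoctahedral (n : ℕ) :
    Subgroup (EuclideanSpace ℝ (Fin n) ≃ₗᵢ[ℝ] EuclideanSpace ℝ (Fin n)) where
  carrier := {w | w '' signedBasis n = signedBasis n}
  one_mem' := by
    change (fun x => x) '' _ = _
    simp
  mul_mem' := by
    intro a b ha hb
    change (fun x => a (b x)) '' _ = _
    rw [← Set.image_image (fun x => a x) (fun x => b x)]
    exact (congrArg (fun s => a '' s) hb).trans ha
  inv_mem' := by
    intro a ha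
    change (fun x => a.symm x) '' _ = _
    conv_lhs => rw [← show a '' signedBasis n = signedBasis n from ha]
    rw [Set.image_image]
    simp

theorem finite_signedBasis (n : ℕ) : (signedBasis n).Finite := by
  have h : signedBasis n ⊆ Set.range (fun i : Fin n => EuclideanSpace.single i (1 : ℝ)) ∪
      Set.range (fun i : Fin n => -EuclideanSpace.single i (1 : ℝ)) := by
    rintro x ⟨i, rfl | rfl⟩
    · exact Or.inl ⟨i, rfl⟩
    · exact Or.inr ⟨i, rfl⟩
  exact ((Set.finite_range _).union (Set.finite_range _)).subset h

theorem mem_hyperoctahedral_of_single {n : ℕ}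
    {w : EuclideanSpace ℝ (Fin n) ≃ₗᵢ[ℝ] EuclideanSpace ℝ (Fin n)}
    (h : ∀ i, w (EuclideanSpace.single i (1 : ℝ)) ∈ signedBasis n) : w ∈ hyperoctahedral n := by
  have hsub : w '' signedBasis n ⊆ signedBasis n := by
    rintro _ ⟨x, ⟨i, rfl | rfl⟩, rfl⟩
    · exact h i
    · obtain ⟨j, hj | hj⟩ := h i
      · exact ⟨j, Or.inr (by rw [map_neg, hj])⟩
      · exact ⟨j, Or.inl (by rw [map_neg, hj, neg_neg])⟩
  change w '' signedBasis n = signedBasis n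
  exact Set.eq_of_subset_of_ncard_le hsub
    (Set.ncard_image_of_injective _ w.injective).ge (finite_signedBasis n)

instance finite_hyperoctahedral (n : ℕ) : Finite (hyperoctahedral n) := by
  have := (finite_signedBasis n).to_subtype
  let f : hyperoctahedral n → Fin n → signedBasis n := fun w i =>
    ⟨w.1 (EuclideanSpace.single i (1 : ℝ)), by
      have hw : w.1 '' signedBasis n = signedBasis n := w.2
      rw [← hw]
      exact Set.mem_image_of_mem _ ⟨i, Or.inl rfl⟩⟩
  refine Finite.of_injective f fun a b hab => ?_
  apply Subtype.ext
  apply LinearIsometryEquiv.toLinearEquiv_injective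
  refine (EuclideanSpace.basisFun (Fin n) ℝ).toBasis.ext' fun i => ?_
  have := congrArg Subtype.val (congrFun hab i)
  simpa [f] using this

/-- The orthogonal reflection of `ℝⁿ` with root `v`, in the hyperplane orthogonal to `v`. -/
def rootReflection {n : ℕ} (v : EuclideanSpace ℝ (Fin n)) :
    EuclideanSpace ℝ (Fin n) ≃ₗᵢ[ℝ] EuclideanSpace ℝ (Fin n) :=
  (Submodule.span ℝ {v})ᗮ.reflection

/-- The reflection `r_i` of `C_n`, with root `e_i`, which inverts the `i`th coordinate. -/
def invertReflection {n : ℕ} (i : Fin n) : hyperoctahedral n :=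
  ⟨rootReflection (EuclideanSpace.single i (1 : ℝ)), by
    refine mem_hyperoctahedral_of_single fun k => ?_
    by_cases hk : k = i
    · subst hk
      exact ⟨k, Or.inr (Submodule.reflection_orthogonalComplement_singleton_eq_neg _)⟩
    · refine ⟨k, Or.inl (Submodule.reflection_mem_subspace_eq_self ?_)⟩
      rw [Submodule.mem_orthogonal_singleton_iff_inner_right]
      simp [EuclideanSpace.inner_single_left, Ne.symm hk]⟩

theorem rootReflection_sub_single {n : ℕ} (i j : Fin n) :
    rootReflection (EuclideanSpace.single i (1 : ℝ) - EuclideanSpace.single j (1 : ℝ))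
      (EuclideanSpace.single i (1 : ℝ)) = EuclideanSpace.single j (1 : ℝ) :=
  Submodule.reflection_sub (by simp)

theorem rootReflection_rootReflection {n : ℕ} (v x : EuclideanSpace ℝ (Fin n)) :
    rootReflection v (rootReflection v x) = x :=
  Submodule.reflection_reflection _ _

/-- The reflection `r_{+1,i,j}` of `C_n`, for `i ≠ j`, with root `e_i - e_j`, which permutes
the `i`th and `j`th coordinates. -/
def permuteReflection {n : ℕ} (i j : Fin n) : hyperoctahedral n :=
  ⟨rootReflection (EuclideanSpace.single i (1 : ℝ) - EuclideanSpace.single j (1 : ℝ)), by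
    refine mem_hyperoctahedral_of_single fun k => ?_
    by_cases hi : k = i
    · rw [hi]
      exact ⟨j, Or.inl (rootReflection_sub_single i j)⟩
    by_cases hj : k = j
    · refine ⟨i, Or.inl ?_⟩
      have h := congrArg (rootReflection (EuclideanSpace.single i (1 : ℝ) -
        EuclideanSpace.single j (1 : ℝ))) (rootReflection_sub_single i j)
      rw [rootReflection_rootReflection] at h
      rw [hj]
      exact h.symm
    · refine ⟨k, Or.inl (Submodule.reflection_mem_subspace_eq_self ?_)⟩
      rw [Submodule.mem_orthogonal_singleton_iff_inner_right]
      simp [inner_sub_left, EuclideanSpace.inner_single_left, Ne.symm hi, Ne.symm hj]⟩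

/-- The probability that the element `g` of the finite group `G` lies in the kernel of an
endomorphism of `G` drawn uniformly at random from the finite set of all endomorphisms of `G`. -/
def probMemKer (G : Type) [Group G] [Finite G] (g : G) : ℝ :=
  (Nat.card {φ : G →* G // g ∈ φ.ker} : ℝ) / (Nat.card (G →* G) : ℝ)

end

/-! The group is that of signed permutations, the sign vectors extended by Sₙ, and its endomorphisms
φ split according to whether φ is trivial on Aₙ. If it is, φ is determined by the images of one
transposition and one sign change, which commute and square to 1. There are at most 512ⁿ·n^(n-⌈n/4⌉)
such pairs (`card_killsAlternating_le`), negligible against the n! conjugations by permutations,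
which for n ≥ 3 are nontrivial on Aₙ. A φ that kills a transposition kills Aₙ, so the first limit is
0.

If φ is nontrivial on Aₙ and n ≥ 7, it induces an automorphism α of Sₙ (`permPart_bijective`) and
preserves the sign vectors (`map_inl_eq`). The endomorphisms with the same restriction to Sₙ
correspond to the possible images of the sign change at x, namely the sign vectors fixed by α(Stab
x) (`fiberEquiv`). As α preserves transpositions (`isSwap_mulAut`), α(Stab x) is the stabilizer of a
nonempty proper subset O, and its fixed sign vectors are those constant on O and on its complement.
There are four (`card_invariant`), and exactly one of them is trivial, so the second limit is 1/4.
-/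

/-! ### Centralizer orders of involutions in Sₙ -/

theorem two_pow_mul_factorial_lt {k : ℕ} (hk : 2 ≤ k) :
    2 ^ k * k.factorial < 2 * (2 * k - 1).factorial := by
  induction k, hk using Nat.le_induction with
  | base => decide
  | succ k hk ih =>
    obtain ⟨m, rfl⟩ : ∃ m, k = m + 2 := ⟨k - 2, by omega⟩
    have e1 : 2 * (m + 2 + 1) - 1 = (2 * (m + 2) - 1) + 1 + 1 := by omega
    rw [e1, Nat.factorial_succ (m + 2), Nat.factorial_succ (2 * (m + 2) - 1 + 1),
      Nat.factorial_succ (2 * (m + 2) - 1), pow_succ]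
    have hle : 2 * (m + 2 + 1) ≤
        (2 * (m + 2) - 1 + 1 + 1) * (2 * (m + 2) - 1 + 1) := by
      have h1 : 2 * (m + 2) - 1 + 1 + 1 = 2 * m + 5 := by omega
      have h2 : 2 * (m + 2) - 1 + 1 = 2 * m + 4 := by omega
      rw [h1, h2]; nlinarith
    calc 2 ^ (m + 2) * 2 * ((m + 2 + 1) * (m + 2).factorial)
        = (2 * (m + 2 + 1)) * (2 ^ (m + 2) * (m + 2).factorial) := by ring
      _ < (2 * (m + 2 + 1)) * (2 * (2 * (m + 2) - 1).factorial) := by gcongr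
      _ ≤ ((2 * (m + 2) - 1 + 1 + 1) * (2 * (m + 2) - 1 + 1)) *
          (2 * (2 * (m + 2) - 1).factorial) := by gcongr
      _ = _ := by ring

/-- Serves the fixed-point-free case n = 2k. At k = 3 both sides equal 48: this is the coincidence
behind the outer automorphism of S₆, and the reason for requiring degree at least 7. -/
theorem two_pow_mul_factorial_lt' {k : ℕ} (hk : 4 ≤ k) :
    2 ^ k * k.factorial < 2 * (2 * k - 2).factorial := by
  induction k, hk using Nat.le_induction with
  | base => decide
  | succ k hk ih =>
    obtain ⟨m, rfl⟩ : ∃ m, k = m + 2 := ⟨k - 2, by omega⟩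
    have e1 : 2 * (m + 2 + 1) - 2 = (2 * (m + 2) - 2) + 1 + 1 := by omega
    rw [e1, Nat.factorial_succ (m + 2), Nat.factorial_succ (2 * (m + 2) - 2 + 1),
      Nat.factorial_succ (2 * (m + 2) - 2), pow_succ]
    have hle : 2 * (m + 2 + 1) ≤
        (2 * (m + 2) - 2 + 1 + 1) * (2 * (m + 2) - 2 + 1) := by
      have h1 : 2 * (m + 2) - 2 + 1 + 1 = 2 * m + 4 := by omega
      have h2 : 2 * (m + 2) - 2 + 1 = 2 * m + 3 := by omega
      rw [h1, h2]; nlinarith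
    calc 2 ^ (m + 2) * 2 * ((m + 2 + 1) * (m + 2).factorial)
        = (2 * (m + 2 + 1)) * (2 ^ (m + 2) * (m + 2).factorial) := by ring
      _ < (2 * (m + 2 + 1)) * (2 * (2 * (m + 2) - 2).factorial) := by gcongr
      _ ≤ ((2 * (m + 2) - 2 + 1 + 1) * (2 * (m + 2) - 2 + 1)) *
          (2 * (2 * (m + 2) - 2).factorial) := by gcongr
      _ = _ := by ring

/-- Among the involutions of a symmetric group of degree at least `7`, those with `k ≥ 2`
two-cycles have a smaller centralizer than the transpositions. -/
theorem card_centralizer_involution_lt {n k : ℕ} (hn : 7 ≤ n) (hk : 2 ≤ k) (hkn : 2 * k ≤ n) :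
    (n - 2 * k).factorial * 2 ^ k * k.factorial < (n - 2).factorial * 2 := by
  rcases hkn.eq_or_lt with rfl | hlt
  · have := two_pow_mul_factorial_lt' (k := k) (by omega)
    simp only [Nat.sub_self, Nat.factorial_zero, one_mul]
    linarith
  · have h1 := two_pow_mul_factorial_lt hk
    obtain ⟨m, hm⟩ : ∃ m, n = 2 * k + 1 + m := ⟨n - (2 * k + 1), by omega⟩
    have e1 : n - 2 = (2 * k - 1) + m := by omega
    have e2 : n - 2 * k = m + 1 := by omega
    have h2 : (2 * k - 1).factorial * (m + 1).factorial ≤ ((2 * k - 1) + m).factorial := by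
      have h3 := Nat.add_choose_mul_factorial_mul_factorial (2 * k - 1) m
      have h4 : m + 1 ≤ (2 * k - 1 + m).choose m := by
        calc m + 1 = (m + 1).choose m := by simp
          _ ≤ _ := Nat.choose_le_choose _ (by omega)
      rw [← h3, Nat.factorial_succ]
      calc (2 * k - 1).factorial * ((m + 1) * m.factorial)
          = (m + 1) * ((2 * k - 1).factorial * m.factorial) := by ring
        _ ≤ (2 * k - 1 + m).choose m * ((2 * k - 1).factorial * m.factorial) := by
          gcongr
        _ = _ := by ring
    rw [e1, e2]
    have h3 : 0 < (m + 1).factorial := Nat.factorial_pos _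
    calc (m + 1).factorial * 2 ^ k * k.factorial
        = (m + 1).factorial * (2 ^ k * k.factorial) := by ring
      _ < (m + 1).factorial * (2 * (2 * k - 1).factorial) := by gcongr
      _ = 2 * ((2 * k - 1).factorial * (m + 1).factorial) := by ring
      _ ≤ 2 * ((2 * k - 1) + m).factorial := by gcongr
      _ = _ := by ring

/-! ### Automorphisms of symmetric groups -/

section Perm

variable {X : Type*} [Fintype X] [DecidableEq X]

open Equiv Equiv.Perm MulAction
open scoped Pointwise

/-- Automorphisms of a symmetric group of degree at least `7` preserve transpositions. -/
theorem isSwap_mulAut (hX : 7 ≤ Nat.card X) (α : Perm X ≃* Perm X) {σ : Perm X}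
    (hσ : σ.IsSwap) : (α σ).IsSwap := by
  rw [Nat.card_eq_fintype_card] at hX
  rw [Equiv.Perm.isSwap_iff_cycleType] at hσ ⊢
  have ho : orderOf (α σ) = 2 := by
    rw [MulEquiv.orderOf_eq, ← Equiv.Perm.lcm_cycleType, hσ]
    simp
  obtain ⟨k, hk⟩ := Equiv.Perm.cycleType_prime_order (σ := α σ) (by rw [ho]; exact Nat.prime_two)
  rw [ho] at hk
  -- An automorphism preserves centralizer orders, and these separate transpositions from the other
  -- involutions.
  have hcard : Nat.card (Subgroup.centralizer {α σ}) = Nat.card (Subgroup.centralizer {σ}) := by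
    refine Nat.card_congr (α.toEquiv.subtypeEquiv fun τ => ?_).symm
    simp only [Subgroup.mem_centralizer_singleton_iff]
    simp [← map_mul]
  rw [Equiv.Perm.nat_card_centralizer, Equiv.Perm.nat_card_centralizer, hσ, hk] at hcard
  have hle : (α σ).cycleType.sum ≤ Fintype.card X := by
    rw [Equiv.Perm.sum_cycleType]; exact Finset.card_le_univ _
  rw [hk, Multiset.sum_replicate, smul_eq_mul] at hle
  rw [hk]
  -- The number of two-cycles is k + 1, so k = 0 is the case of a transposition.
  rcases Nat.eq_zero_or_pos k with rfl | hkpos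
  · rfl
  · exfalso
    have := card_centralizer_involution_lt (k := k + 1) hX (by omega) (by
      linarith)
    rw [Multiset.toFinset_replicate, if_neg (by omega), Multiset.sum_replicate,
      Multiset.prod_replicate, Finset.prod_singleton, Multiset.count_replicate_self, smul_eq_mul,
      mul_comm (k + 1) 2] at hcard
    simp at hcard
    omega

/-- A group generated by transpositions contains every permutation that preserves its orbits. If f
fixes x and moves y, the transposition of y and f y also fixes x. -/
theorem stabilizer_eq_closure_isSwap (x : X) :
    stabilizer (Perm X) x = Subgroup.closure {σ | σ.IsSwap ∧ σ x = x} := by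
  apply le_antisymm
  · intro f hf
    rw [mem_closure_isSwap fun σ hσ => hσ.1]
    refine ⟨Set.toFinite _, fun y => ?_⟩
    by_cases hy : f y = y
    · rw [hy]; exact mem_orbit_self y
    · refine ⟨⟨swap y (f y), Subgroup.subset_closure ⟨⟨y, f y, Ne.symm hy, rfl⟩, ?_⟩⟩, ?_⟩
      · have hfx : f x = x := hf
        refine swap_apply_of_ne_of_ne ?_ ?_
        · rintro rfl; exact hy hfx
        · intro h
          exact hy (by rw [← f.injective (hfx.trans h), hfx])
      · exact swap_apply_left y (f y)
  · rw [Subgroup.closure_le]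
    exact fun σ hσ => hσ.2

/-- The image is generated by transpositions, so transitivity would make it all of `Perm X`, whereas
the stabilizer is proper. -/
theorem not_isPretransitive_map_stabilizer (hX : 7 ≤ Nat.card X) (α : Perm X ≃* Perm X) (x : X) :
    ¬ IsPretransitive ((stabilizer (Perm X) x).map α.toMonoidHom) X := by
  have : Nontrivial X := Finite.one_lt_card_iff_nontrivial.mp (by omega)
  intro h
  rw [stabilizer_eq_closure_isSwap, MonoidHom.map_closure] at h
  have htop := closure_of_isSwap_of_isPretransitive
    (S := α.toMonoidHom '' {σ | σ.IsSwap ∧ σ x = x})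
    (by rintro _ ⟨σ, hσ, rfl⟩; exact isSwap_mulAut hX α hσ.1)
  rw [← MonoidHom.map_closure, ← stabilizer_eq_closure_isSwap] at htop
  have h2 : stabilizer (Perm X) x = ⊤ := by
    apply Subgroup.map_injective (f := α.toMonoidHom) α.injective
    rw [htop, Subgroup.map_top_of_surjective _ α.surjective]
  exact (IsPreprimitive.isCoatom_stabilizer_of_isPreprimitive (G := Perm X) x).1 h2

/-- An automorphism of a symmetric group maps point stabilizers to set stabilizers. -/
theorem exists_map_stabilizer_eq (hX : 7 ≤ Nat.card X) (α : Perm X ≃* Perm X) (x : X) :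
    ∃ O : Set X, O.Nonempty ∧ Oᶜ.Nonempty ∧
      (stabilizer (Perm X) x).map α.toMonoidHom = stabilizer (Perm X) O := by
  have : Nontrivial X := Finite.one_lt_card_iff_nontrivial.mp (by omega)
  set H := (stabilizer (Perm X) x).map α.toMonoidHom with hH
  have hco : IsCoatom H := by
    have h := IsPreprimitive.isCoatom_stabilizer_of_isPreprimitive (G := Perm X) x
    exact (OrderIso.isCoatom_iff (α.mapSubgroup) _).2 h
  set O := orbit H x with hO
  have hne : O ≠ Set.univ := fun h => not_isPretransitive_map_stabilizer hX α x
    ⟨fun a b => by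
      have ha : a ∈ O := h ▸ Set.mem_univ a
      have hb : b ∈ O := h ▸ Set.mem_univ b
      rw [hO, ← orbit_eq_iff.2 ha] at hb
      exact hb⟩
  have hOc : Oᶜ.Nonempty := Set.nonempty_compl.2 hne
  refine ⟨O, ⟨x, mem_orbit_self x⟩, hOc, ?_⟩
  have hle : H ≤ stabilizer (Perm X) O := by
    intro h hh
    have := smul_orbit (⟨h, hh⟩ : H) x
    exact this
  -- H is maximal because point stabilizers are, so it remains to see that the stabilizer of O is
  -- proper: exchanging x with a point outside O does not preserve O.
  refine (hco.le_iff_eq ?_).1 hle |>.symm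
  intro htop
  obtain ⟨y, hy⟩ := hOc
  have hs : swap x y ∈ stabilizer (Perm X) O := htop ▸ Subgroup.mem_top _
  have hxy : swap x y • x ∈ swap x y • O := Set.smul_mem_smul_set (mem_orbit_self x)
  rw [mem_stabilizer_iff.1 hs] at hxy
  simp only [Perm.smul_def, swap_apply_left] at hxy
  exact hy hxy

end Perm

/-! ### Counting pairs of commuting involutions -/

section Involutions

/-- The pairs of commuting elements of order at most two. -/
def CommutingInvolutions (G : Type*) [Group G] : Type _ :=
  {p : G × G // p.1 * p.1 = 1 ∧ p.2 * p.2 = 1 ∧ p.1 * p.2 = p.2 * p.1}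

instance (G : Type*) [Group G] [Finite G] : Finite (CommutingInvolutions G) :=
  inferInstanceAs (Finite (Subtype _))

open Equiv

namespace CommutingInvolutions

/-- The four elements of the group generated by two commuting involutions. -/
def word {G : Type*} [Group G] (p : CommutingInvolutions G) (b : Bool × Bool) : G :=
  (if b.1 then p.1.1 else 1) * (if b.2 then p.1.2 else 1)

theorem word_mul_word {G : Type*} [Group G] (p : CommutingInvolutions G) (b c : Bool × Bool) :
    p.word b * p.word c = p.word (b.1 ^^ c.1, b.2 ^^ c.2) := by
  obtain ⟨⟨x, y⟩, hx, hy, hxy⟩ := p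
  have h1 : x * (x * y) = y := by rw [← mul_assoc, hx, one_mul]
  have h2 : y * (x * y) = x := by rw [← mul_assoc, ← hxy, mul_assoc, hy, mul_one]
  have h3 : y * x = x * y := hxy.symm
  dsimp only at hx hy
  obtain ⟨_ | _, _ | _⟩ := b <;> obtain ⟨_ | _, _ | _⟩ := c <;>
    simp [word, mul_assoc, hx, hy, h1, h2, h3]

variable {n : ℕ} (p : CommutingInvolutions (Perm (Fin n)))

/-- The orbit of a point under two commuting involutions. -/
def orb (i : Fin n) : Finset (Fin n) := Finset.univ.image fun b => p.word b i

theorem mem_orb_self (i : Fin n) : i ∈ p.orb i :=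
  Finset.mem_image.2 ⟨(false, false), Finset.mem_univ _, by simp [word]⟩

theorem orb_eq {i j : Fin n} (h : j ∈ p.orb i) : p.orb j = p.orb i := by
  obtain ⟨b, -, rfl⟩ := Finset.mem_image.1 h
  have key : ∀ c, p.word c (p.word b i) = p.word (c.1 ^^ b.1, c.2 ^^ b.2) i := fun c => by
    rw [← word_mul_word, Perm.mul_apply]
  ext k
  simp only [orb, Finset.mem_image, Finset.mem_univ, true_and, key]
  constructor
  · rintro ⟨c, rfl⟩
    exact ⟨_, rfl⟩
  · rintro ⟨c, rfl⟩
    exact ⟨(c.1 ^^ b.1, c.2 ^^ b.2), by simp⟩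

theorem card_orb_le (i : Fin n) : (p.orb i).card ≤ 4 :=
  Finset.card_image_le.trans (by simp)

/-- The least point of the orbit. -/
def rep (i : Fin n) : Fin n := (p.orb i).min' ⟨i, p.mem_orb_self i⟩

theorem rep_mem (i : Fin n) : p.rep i ∈ p.orb i := Finset.min'_mem _ _

theorem rep_congr {i j : Fin n} (h : j ∈ p.orb i) : p.rep j = p.rep i := by
  unfold rep
  congr 1
  exact p.orb_eq h

theorem exists_word_rep (i : Fin n) : ∃ b, p.word b (p.rep i) = i := by
  have h : i ∈ p.orb (p.rep i) := by
    rw [p.orb_eq (p.rep_mem i)]; exact p.mem_orb_self i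
  obtain ⟨b, -, hb⟩ := Finset.mem_image.1 h
  exact ⟨b, hb⟩

/-- An element of the group generated that maps the representative of the orbit to the point. -/
noncomputable def label (i : Fin n) : Bool × Bool := (p.exists_word_rep i).choose

theorem word_label (i : Fin n) : p.word (p.label i) (p.rep i) = i :=
  (p.exists_word_rep i).choose_spec

/-- The data that determine a pair of commuting involutions. -/
noncomputable def code : (Fin n → Fin n) × (Fin n → Bool × Bool) × (Fin n → Bool × Bool) ×
    (Fin n → Bool × Bool) :=
  (p.rep, p.label, fun i => p.label (p.1.1 i), fun i => p.label (p.1.2 i))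

theorem fst_mem_orb (i : Fin n) : p.1.1 i ∈ p.orb i :=
  Finset.mem_image.2 ⟨(true, false), Finset.mem_univ _, by simp [word]⟩

theorem snd_mem_orb (i : Fin n) : p.1.2 i ∈ p.orb i :=
  Finset.mem_image.2 ⟨(false, true), Finset.mem_univ _, by simp [word]⟩

theorem eq_of_rep_label {i j : Fin n} (h : p.rep i = p.rep j) (h' : p.label i = p.label j) :
    i = j := by
  rw [← p.word_label i, ← p.word_label j, h, h']

/-- A point is recovered from its representative and its label. Both involutions preserve
representatives, so their effect on labels determines them. -/
theorem code_injective :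
    Function.Injective (code : CommutingInvolutions (Perm (Fin n)) → _) := by
  intro p q h
  simp only [code, Prod.mk.injEq] at h
  obtain ⟨h1, h2, h3, h4⟩ := h
  apply Subtype.ext
  apply Prod.ext
  · ext1 i
    refine p.eq_of_rep_label ?_ ?_
    · rw [p.rep_congr (p.fst_mem_orb i), h1, q.rep_congr (q.fst_mem_orb i)]
    · rw [congrFun h3 i, h2]
  · ext1 i
    refine p.eq_of_rep_label ?_ ?_
    · rw [p.rep_congr (p.snd_mem_orb i), h1, q.rep_congr (q.snd_mem_orb i)]
    · rw [congrFun h4 i, h2]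

theorem rep_rep (i : Fin n) : p.rep (p.rep i) = p.rep i := p.rep_congr (p.rep_mem i)

/-- The fibres of `rep` lie in orbits of at most four points. Its values are fixed by it, which
saves a factor of about n^(n/4) in the count. -/
theorem le_card_image_rep : n ≤ 4 * (Finset.univ.image p.rep).card := by
  have h := Finset.card_le_mul_card_image (f := p.rep) (Finset.univ : Finset (Fin n)) 4
    fun r hr => by
      refine (Finset.card_le_card ?_).trans (p.card_orb_le r)
      intro i hi
      simp only [Finset.mem_filter, Finset.mem_univ, true_and] at hi
      rw [← hi, p.orb_eq (p.rep_mem i)]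
      exact p.mem_orb_self i
  simpa using h

end CommutingInvolutions

/-- The self-maps of `Fin n` with at least `n / 4` fixed points. -/
def manyFixed (n : ℕ) : Finset (Fin n → Fin n) :=
  (Finset.univ.filter fun R : Finset (Fin n) => n ≤ 4 * R.card).biUnion fun R =>
    Fintype.piFinset fun i => if i ∈ R then {i} else Finset.univ

/-- There are at most 2ⁿ choices of R, and a map is free only off R, where |R| ≥ ⌈n/4⌉ = (n + 3) /
4. -/
theorem card_manyFixed_le (n : ℕ) : (manyFixed n).card ≤ 2 ^ n * n ^ (n - (n + 3) / 4) := by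
  rcases Nat.eq_zero_or_pos n with rfl | hn
  · exact (Finset.card_le_univ _).trans (by simp)
  refine (Finset.card_biUnion_le_card_mul _ _ (n ^ (n - (n + 3) / 4)) fun R hR => ?_).trans ?_
  · simp only [Finset.mem_filter, Finset.mem_univ, true_and] at hR
    rw [Fintype.card_piFinset]
    have : ∀ i, (if i ∈ R then ({i} : Finset (Fin n)) else Finset.univ).card =
        if i ∈ R then 1 else n := fun i => by split_ifs <;> simp
    simp only [this]
    rw [Finset.prod_ite, Finset.prod_const_one, one_mul, Finset.prod_const,
      Finset.filter_not, Finset.filter_mem_eq_inter, Finset.univ_inter, Finset.card_univ_sdiff,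
      Fintype.card_fin]
    exact Nat.pow_le_pow_right hn (by omega)
  · gcongr
    refine (Finset.card_le_univ _).trans ?_
    simp

theorem CommutingInvolutions.rep_mem_manyFixed {n : ℕ}
    (p : CommutingInvolutions (Perm (Fin n))) : p.rep ∈ manyFixed n := by
  refine Finset.mem_biUnion.2 ⟨Finset.univ.image p.rep, ?_, ?_⟩
  · simpa using p.le_card_image_rep
  · refine Fintype.mem_piFinset.2 fun i => ?_
    split_ifs with h
    · obtain ⟨j, -, rfl⟩ := Finset.mem_image.1 h
      simpa using p.rep_rep j
    · exact Finset.mem_univ _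

/-- The constant is 128 = 2·4³: a factor 2 from `manyFixed` and a factor 4 from each of the three
label functions. -/
theorem card_commutingInvolutions_perm_le (n : ℕ) :
    Nat.card (CommutingInvolutions (Perm (Fin n))) ≤ 128 ^ n * n ^ (n - (n + 3) / 4) := by
  let f : CommutingInvolutions (Perm (Fin n)) →
      manyFixed n × (Fin n → Bool × Bool) × (Fin n → Bool × Bool) × (Fin n → Bool × Bool) :=
    fun p => (⟨p.rep, p.rep_mem_manyFixed⟩, p.code.2)
  have hf : Function.Injective f := by
    intro p q h
    apply CommutingInvolutions.code_injective
    simp only [f, Prod.mk.injEq, Subtype.mk.injEq] at h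
    exact Prod.ext h.1 h.2
  refine (Nat.card_le_card_of_injective f hf).trans ?_
  simp only [Nat.card_eq_fintype_card, Fintype.card_coe, Fintype.card_pi,
    Fintype.card_prod, Fintype.card_bool, Finset.prod_const, Finset.card_univ, Fintype.card_fin]
  calc (manyFixed n).card * ((2 * 2) ^ n * ((2 * 2) ^ n * (2 * 2) ^ n))
      ≤ (2 ^ n * n ^ (n - (n + 3) / 4)) * ((2 * 2) ^ n * ((2 * 2) ^ n * (2 * 2) ^ n)) :=
        Nat.mul_le_mul_right _ (card_manyFixed_le n)
    _ = (2 * ((2 * 2) * ((2 * 2) * (2 * 2)))) ^ n * n ^ (n - (n + 3) / 4) := by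
      simp only [mul_pow]; ring
    _ = _ := by norm_num

end Involutions

/-! ### Asymptotics -/

/-- The bound for the number of homomorphisms with abelian image is negligible. -/
theorem tendsto_pow_mul_pow_div_factorial (C : ℕ) :
    Tendsto (fun n : ℕ => ((C ^ n * n ^ (n - (n + 3) / 4) : ℕ) : ℝ) / (n.factorial : ℝ))
      atTop (𝓝 0) := by
  -- The fourth power clears the quarter in the exponent, as 4(n - ⌈n/4⌉) ≤ 3n. With n! ≥ (n/e)ⁿ it
  -- is at most (K/n)ⁿ, where K = (Ce)⁴.
  have h4 : Tendsto (fun n : ℕ =>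
      (((C ^ n * n ^ (n - (n + 3) / 4) : ℕ) : ℝ) / (n.factorial : ℝ)) ^ 4) atTop (𝓝 0) := by
    set K : ℝ := (C * Real.exp 1) ^ 4 with hK
    have hlim : Tendsto (fun n : ℕ => (1 / 2 : ℝ) ^ n) atTop (𝓝 0) :=
      tendsto_pow_atTop_nhds_zero_of_lt_one (by norm_num) (by norm_num)
    refine squeeze_zero' (Eventually.of_forall fun n => by positivity) ?_ hlim
    filter_upwards [eventually_ge_atTop 1, eventually_ge_atTop ⌈2 * K⌉₊] with n hn hnK
    have hn0 : (0 : ℝ) < n := by exact_mod_cast hn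
    have hnK' : 2 * K ≤ n := Nat.ceil_le.1 hnK
    have hfac : (n : ℝ) ^ n / Real.exp 1 ^ n ≤ n.factorial := by
      have := Real.pow_div_factorial_le_exp (n : ℝ) hn0.le n
      rw [div_le_iff₀ (by positivity)] at this ⊢
      rw [← Real.exp_nat_mul, mul_one, mul_comm]
      exact this
    have hfp : (0 : ℝ) < (n : ℝ) ^ n / Real.exp 1 ^ n := by positivity
    have hpow : ((n : ℝ) ^ (n - (n + 3) / 4)) ^ 4 ≤ (n : ℝ) ^ (3 * n) := by
      rw [← pow_mul]
      exact pow_le_pow_right₀ (by exact_mod_cast hn) (by omega)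
    calc (((C ^ n * n ^ (n - (n + 3) / 4) : ℕ) : ℝ) / (n.factorial : ℝ)) ^ 4
        ≤ (((C ^ n * n ^ (n - (n + 3) / 4) : ℕ) : ℝ) / ((n : ℝ) ^ n / Real.exp 1 ^ n)) ^ 4 := by
          gcongr
      _ = ((C : ℝ) ^ n) ^ 4 * (((n : ℝ) ^ (n - (n + 3) / 4)) ^ 4) * (Real.exp 1 ^ n) ^ 4 /
            ((n : ℝ) ^ n) ^ 4 := by
          push_cast; field_simp
      _ ≤ ((C : ℝ) ^ n) ^ 4 * ((n : ℝ) ^ (3 * n)) * (Real.exp 1 ^ n) ^ 4 / ((n : ℝ) ^ n) ^ 4 := by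
          gcongr
      _ = (K / n) ^ n := by
          rw [hK, div_pow]
          have : ((n : ℝ) ^ n) ^ 4 = (n : ℝ) ^ (3 * n) * (n : ℝ) ^ n := by ring
          rw [this]
          field_simp
          ring
      _ ≤ (1 / 2) ^ n := by
          have : K / n ≤ 1 / 2 := by rw [div_le_iff₀ hn0]; linarith
          gcongr
  have h1 := h4.sqrt.sqrt
  simp only [Real.sqrt_zero] at h1
  refine h1.congr fun n => ?_
  have h0 : (0 : ℝ) ≤ ((C ^ n * n ^ (n - (n + 3) / 4) : ℕ) : ℝ) / (n.factorial : ℝ) := by positivity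
  rw [show (4 : ℕ) = 2 * 2 from rfl, pow_mul, Real.sqrt_sq (by positivity), Real.sqrt_sq h0]

/-! ### The group of signed permutations -/

section SignedPermutations

open Equiv Equiv.Perm MulAction SemidirectProduct
open scoped Pointwise

/-- The group of signed permutations of `X`. -/
abbrev SignedPerm (X : Type*) : Type _ := (X → ℤˣ) ⋊[mulAutArrow (G := Perm X) (M := ℤˣ)] Perm X

theorem mulAutArrow_perm_apply {X : Type*} (σ : Perm X) (v : X → ℤˣ) (i : X) :
    mulAutArrow (G := Perm X) (M := ℤˣ) σ v i = v (σ⁻¹ i) := rfl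

namespace SignedPerm

instance {X : Type*} [Finite X] : Finite (SignedPerm X) := Finite.of_equiv _ equivProd.symm

/-- The permutation parts again form such a pair; the two sign vectors are bounded trivially by 2ⁿ
each. -/
theorem card_commutingInvolutions_le {X : Type*} [Fintype X] :
    Nat.card (CommutingInvolutions (SignedPerm X)) ≤
      4 ^ Fintype.card X * Nat.card (CommutingInvolutions (Perm X)) := by
  let f : CommutingInvolutions (SignedPerm X) →
      ((X → ℤˣ) × (X → ℤˣ)) × CommutingInvolutions (Perm X) := fun p =>
    ((p.1.1.left, p.1.2.left), ⟨(p.1.1.right, p.1.2.right), congrArg SemidirectProduct.right p.2.1,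
      congrArg SemidirectProduct.right p.2.2.1, congrArg SemidirectProduct.right p.2.2.2⟩)
  have hf : Function.Injective f := by
    intro p q h
    have h1 := congrArg Prod.fst h
    have h2 := congrArg (fun z => z.2.1) h
    exact Subtype.ext (Prod.ext
      (SemidirectProduct.ext (congrArg Prod.fst h1) (congrArg Prod.fst h2))
      (SemidirectProduct.ext (congrArg Prod.snd h1) (congrArg Prod.snd h2)))
  classical
  refine (Nat.card_le_card_of_injective f hf).trans ?_
  rw [Nat.card_prod, Nat.card_prod, Nat.card_eq_fintype_card (α := X → ℤˣ)]
  simp [← mul_pow]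

/-- Sign vectors commute with each other, so only the permutation part of g acts. -/
theorem conj_inl {X : Type*} (g : SignedPerm X) (v : X → ℤˣ) :
    g * inl v * g⁻¹ = inl (mulAutArrow (G := Perm X) (M := ℤˣ) g.right v) := by
  have hg : g = inl g.left * inr g.right := (inl_left_mul_inr_right g).symm
  rw [inl_aut]
  conv_lhs => rw [hg]
  have : (inl g.left : SignedPerm X) * inr g.right * inl v * (inl g.left * inr g.right)⁻¹ =
      inl g.left * (inr g.right * inl v * inr g.right⁻¹) * (inl g.left)⁻¹ := by
    rw [map_inv]; group
  rw [this, ← inl_aut, ← map_inv, ← map_mul, ← map_mul, mul_comm, inv_mul_cancel_left]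

variable {X : Type*} [DecidableEq X]

/-- The sign change of one coordinate. -/
def flip (i : X) : SignedPerm X := inl (Pi.mulSingle i (-1))

theorem mulAutArrow_mulSingle (σ : Perm X) (i : X) (u : ℤˣ) :
    mulAutArrow (G := Perm X) (M := ℤˣ) σ (Pi.mulSingle i u) = Pi.mulSingle (σ i) u := by
  ext j
  rw [mulAutArrow_perm_apply]
  by_cases h : j = σ i
  · subst h; simp
  · rw [Pi.mulSingle_eq_of_ne h, Pi.mulSingle_eq_of_ne]
    rintro rfl
    simp at h

theorem inr_mul_flip_mul_inr_inv (σ : Perm X) (i : X) :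
    inr σ * flip i * (inr σ)⁻¹ = flip (σ i) := by
  rw [flip, flip, ← mulAutArrow_mulSingle, inl_aut, map_inv]

theorem flip_mul_self (i : X) : flip i * flip i = 1 := by
  rw [flip, ← map_mul, ← Pi.mulSingle_mul]; simp

theorem inl_hom_ext [Finite X] {G : Type*} [Group G] {φ ψ : (X → ℤˣ) →* G}
    (h : ∀ i, φ (Pi.mulSingle i (-1)) = ψ (Pi.mulSingle i (-1))) : φ = ψ := by
  refine MonoidHom.pi_ext fun i u => ?_
  rcases Int.units_eq_one_or u with rfl | rfl
  · simp
  · exact h i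

/-- A homomorphism is determined by its values on permutations and on one sign change. -/
theorem hom_ext [Finite X] {G : Type*} [Group G] {φ ψ : SignedPerm X →* G} (x : X)
    (hr : φ.comp inr = ψ.comp inr) (hx : φ (flip x) = ψ (flip x)) : φ = ψ := by
  refine SemidirectProduct.hom_ext (inl_hom_ext fun i => ?_) hr
  change φ (flip i) = ψ (flip i)
  have h : ∀ σ, φ (inr σ) = ψ (inr σ) := fun σ => DFunLike.congr_fun hr σ
  rw [show i = swap x i x by simp, ← inr_mul_flip_mul_inr_inv]
  simp only [map_mul, map_inv, h, hx]

variable [Fintype X]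

/-! ### Homomorphisms trivial on the alternating group -/

/-- The homomorphisms that are trivial on even permutations. -/
def KillsAlternating {G : Type*} [Group G] (φ : SignedPerm X →* G) : Prop :=
  ∀ σ ∈ alternatingGroup X, φ (inr σ) = 1

/-- A 3-cycle, hence an even permutation, carries x to z and conjugates one sign change to the
other. -/
theorem KillsAlternating.map_flip {G : Type*} [Group G] {φ : SignedPerm X →* G}
    (h : KillsAlternating φ) {x y z : X} (hxy : x ≠ y) (hxz : x ≠ z) (hyz : y ≠ z) :
    φ (flip x) = φ (flip z) := by
  have hσ : swap x y * swap x z ∈ alternatingGroup X :=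
    mul_mem_alternatingGroup_of_isSwap ⟨x, y, hxy, rfl⟩ ⟨x, z, hxz, rfl⟩
  have e : (swap x y * swap x z) x = z := by
    rw [Perm.mul_apply, swap_apply_left, swap_apply_of_ne_of_ne hxz.symm hyz.symm]
  have := congrArg φ (inr_mul_flip_mul_inr_inv (swap x y * swap x z) x)
  rw [e, map_mul, map_mul, map_inv, h _ hσ] at this
  simpa using this

/-- The transposition commutes with the sign change at the third point z, which has the same image
as the one at x. -/
theorem KillsAlternating.commutes {G : Type*} [Group G] {φ : SignedPerm X →* G}
    (h : KillsAlternating φ) {x y z : X} (hxy : x ≠ y) (hxz : x ≠ z) (hyz : y ≠ z) :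
    φ (inr (swap x y)) * φ (flip x) = φ (flip x) * φ (inr (swap x y)) := by
  have h1 := congrArg φ (inr_mul_flip_mul_inr_inv (swap x y) z)
  rw [swap_apply_of_ne_of_ne hxz.symm hyz.symm, map_mul, map_mul, map_inv,
    ← h.map_flip hxy hxz hyz, mul_inv_eq_iff_eq_mul] at h1
  exact h1

theorem KillsAlternating.ext {G : Type*} [Group G] {φ ψ : SignedPerm X →* G}
    (hφ : KillsAlternating φ) (hψ : KillsAlternating ψ) {x y : X} (hxy : x ≠ y)
    (hs : φ (inr (swap x y)) = ψ (inr (swap x y))) (hf : φ (flip x) = ψ (flip x)) : φ = ψ := by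
  refine hom_ext x (MonoidHom.ext fun σ => ?_) hf
  change φ (inr σ) = ψ (inr σ)
  rcases Int.units_eq_one_or (sign σ) with h | h
  · rw [hφ σ h, hψ σ h]
  · have h' : swap x y * σ ∈ alternatingGroup X := by
      rw [mem_alternatingGroup, Perm.sign_mul, sign_swap hxy, h]; rfl
    have e : inr σ = (inr (swap x y) : SignedPerm X)⁻¹ * inr (swap x y * σ) := by
      rw [map_mul, inv_mul_cancel_left]
    rw [e, φ.map_mul, ψ.map_mul, hφ _ h', hψ _ h', map_inv, map_inv, hs]

theorem card_killsAlternating_le_commutingInvolutions {G : Type*} [Group G] [Finite G]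
    (hX : 3 ≤ Nat.card X) :
    Nat.card {φ : SignedPerm X →* G // KillsAlternating φ} ≤
      Nat.card (CommutingInvolutions G) := by
  rw [Nat.card_eq_fintype_card] at hX
  obtain ⟨x, y, z, hxy, hxz, hyz⟩ := Fintype.two_lt_card_iff.1 hX
  refine Nat.card_le_card_of_injective
    (fun φ => (⟨(φ.1 (inr (swap x y)), φ.1 (flip x)), ?_, ?_, ?_⟩ : CommutingInvolutions G)) ?_
  · dsimp only; rw [← map_mul, ← map_mul, swap_mul_self, map_one, map_one]
  · dsimp only; rw [← map_mul, flip_mul_self, map_one]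
  · exact φ.2.commutes hxy hxz hyz
  · intro φ ψ h
    have h' := congrArg Subtype.val h
    simp only [Prod.mk.injEq] at h'
    exact Subtype.ext (φ.2.ext ψ.2 hxy h'.1 h'.2)

theorem card_killsAlternating_le {n : ℕ} (hn : 3 ≤ n) :
    Nat.card {φ : SignedPerm (Fin n) →* SignedPerm (Fin n) // KillsAlternating φ} ≤
      512 ^ n * n ^ (n - (n + 3) / 4) := by
  refine (card_killsAlternating_le_commutingInvolutions (by simpa using hn)).trans ?_
  refine card_commutingInvolutions_le.trans ?_
  rw [Fintype.card_fin]
  refine (Nat.mul_le_mul_left _ (card_commutingInvolutions_perm_le n)).trans_eq ?_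
  rw [← mul_assoc, ← mul_pow]
  norm_num

/-- A homomorphism that kills a transposition kills all even permutations. -/
theorem killsAlternating_of_swap {G : Type*} [Group G] {φ : SignedPerm X →* G} {x y : X}
    (hxy : x ≠ y) (h : φ (inr (swap x y)) = 1) : KillsAlternating φ := by
  intro σ _
  have hs : ∀ τ : Perm X, τ.IsSwap → φ (inr τ) = 1 := by
    intro τ hτ
    obtain ⟨c, rfl⟩ := isConj_iff.1 (isConj_iff_cycleType_eq.2
      ((isSwap_iff_cycleType.1 ⟨x, y, hxy, rfl⟩).trans (isSwap_iff_cycleType.1 hτ).symm) :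
        IsConj (swap x y) τ)
    simp [h]
  have : (⊤ : Subgroup (Perm X)) ≤ (φ.comp inr).ker := by
    rw [← closure_isSwap, Subgroup.closure_le]
    exact fun τ hτ => hs τ hτ
  exact this (Subgroup.mem_top σ)

/-! ### Endomorphisms nontrivial on the alternating group -/

section NotKills

variable {φ : SignedPerm X →* SignedPerm X}

/-- The action on the coordinates of the images of the permutations. -/
def permPart (ψ : Perm X →* SignedPerm X) : Perm X →* Perm X := rightHom.comp ψ

/-- A nontrivial kernel contains Aₙ, so φ maps Aₙ into the abelian group of sign vectors. As Aₙ is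
perfect, φ then kills it. -/
theorem permPart_bijective (hX : 5 ≤ Nat.card X) (h : ¬ KillsAlternating φ) :
    Function.Bijective (permPart (φ.comp inr)) := by
  rw [← Finite.injective_iff_bijective, ← MonoidHom.ker_eq_bot_iff]
  by_contra hne
  have := (Subgroup.nontrivial_iff_ne_bot _).2 hne
  have hle := alternatingGroup_le_of_normal hX this
  apply h
  intro σ hσ
  rw [← commutator_alternatingGroup_eq_self hX] at hσ
  have : ⁅alternatingGroup X, alternatingGroup X⁆ ≤ (φ.comp inr).ker := by
    rw [Subgroup.commutator_le]
    intro a ha b hb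
    have key : ∀ c ∈ alternatingGroup X, ∃ v, φ (inr c) = inl v := by
      intro c hc
      have : φ (inr c) ∈ (rightHom : SignedPerm X →* Perm X).ker := hle hc
      rw [← range_inl_eq_ker_rightHom] at this
      obtain ⟨v, hv⟩ := this
      exact ⟨v, hv.symm⟩
    obtain ⟨v, hv⟩ := key a ha
    obtain ⟨w, hw⟩ := key b hb
    rw [MonoidHom.mem_ker, map_commutatorElement, commutatorElement_eq_one_iff_mul_comm]
    change φ (inr a) * φ (inr b) = φ (inr b) * φ (inr a)
    rw [hv, hw, ← map_mul, ← map_mul, mul_comm]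
  exact this hσ

/-- The image of the sign vectors in Sₙ is abelian, and normal because `permPart` is onto. A
nontrivial normal subgroup would contain the nonabelian group Aₙ. -/
theorem right_map_inl (hX : 5 ≤ Nat.card X) (h : ¬ KillsAlternating φ) (v : X → ℤˣ) :
    (φ (inl v)).right = 1 := by
  set β : (X → ℤˣ) →* Perm X := rightHom.comp (φ.comp inl) with hβ
  have hbij := permPart_bijective hX h
  have hn : β.range.Normal := by
    constructor
    rintro _ ⟨w, rfl⟩ g
    obtain ⟨σ, rfl⟩ := hbij.2 g
    refine ⟨mulAutArrow (G := Perm X) (M := ℤˣ) σ w, ?_⟩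
    simp [hβ, permPart, inl_aut]
  have hbot : β.range = ⊥ := by
    by_contra hne
    have := (Subgroup.nontrivial_iff_ne_bot _).2 hne
    have hle := alternatingGroup_le_of_normal hX this
    have hcomm : ⁅alternatingGroup X, alternatingGroup X⁆ ≤ ⊥ := by
      rw [Subgroup.commutator_le]
      intro a ha b hb
      obtain ⟨v, rfl⟩ := hle ha
      obtain ⟨w, rfl⟩ := hle hb
      rw [Subgroup.mem_bot, commutatorElement_eq_one_iff_mul_comm, ← map_mul, ← map_mul, mul_comm]
    rw [commutator_alternatingGroup_eq_self hX] at hcomm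
    have := alternatingGroup.nontrivial_of_three_le_card (α := X) (by omega)
    exact (Subgroup.nontrivial_iff_ne_bot _).1 this (le_bot_iff.1 hcomm)
  have : β v ∈ β.range := ⟨v, rfl⟩
  rw [hbot] at this
  exact this

theorem map_inl_eq (hX : 5 ≤ Nat.card X) (h : ¬ KillsAlternating φ) (v : X → ℤˣ) :
    φ (inl v) = inl (φ (inl v)).left :=
  SemidirectProduct.ext rfl (right_map_inl hX h v)

/-- The sign vectors invariant under the image of the stabilizer of `x`. -/
def Invariant (ψ : Perm X →* SignedPerm X) (x : X) (t : X → ℤˣ) : Prop :=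
  ∀ σ : Perm X, σ x = x → mulAutArrow (G := Perm X) (M := ℤˣ) (permPart ψ σ) t = t

/-- The endomorphism of the sign vectors that maps the sign change at `x` to `t`. -/
def extendSign (ψ : Perm X →* SignedPerm X) (x : X) (t : X → ℤˣ) : (X → ℤˣ) →* (X → ℤˣ) where
  -- Written additively over 𝔽₂ this is ∑ᵢ vᵢ tᵢ, where tᵢ is the translate of t by the image of the
  -- transposition of x and i.
  toFun v j := ∏ i, if mulAutArrow (G := Perm X) (M := ℤˣ) (permPart ψ (swap x i)) t j = -1
    then v i else 1
  map_one' := by ext; simp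
  map_mul' v w := by
    funext j
    simp only [Pi.mul_apply, ← Finset.prod_mul_distrib]
    refine Finset.prod_congr rfl fun i _ => ?_
    split_ifs <;> simp

theorem extendSign_mulSingle (ψ : Perm X →* SignedPerm X) (x : X) (t : X → ℤˣ) :
    extendSign ψ x t (Pi.mulSingle x (-1)) = t := by
  funext j
  change (∏ i, if mulAutArrow (G := Perm X) (M := ℤˣ) (permPart ψ (swap x i)) t j = -1
    then (Pi.mulSingle x (-1) : X → ℤˣ) i else 1) = t j
  rw [Finset.prod_eq_single x]
  · rw [swap_self, show (Equiv.refl X : Perm X) = 1 from rfl, map_one, map_one]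
    rcases Int.units_eq_one_or (t j) with h | h <;> simp [h]
  · intro i _ hi
    rw [Pi.mulSingle_eq_of_ne hi, ite_self]
  · simp

theorem extendSign_equivariant {ψ : Perm X →* SignedPerm X} {x : X} {t : X → ℤˣ}
    (ht : Invariant ψ x t) (σ : Perm X) (v : X → ℤˣ) :
    extendSign ψ x t (mulAutArrow (G := Perm X) (M := ℤˣ) σ v) =
      mulAutArrow (G := Perm X) (M := ℤˣ) (permPart ψ σ) (extendSign ψ x t v) := by
  have key : ∀ i, mulAutArrow (G := Perm X) (M := ℤˣ) (permPart ψ (swap x (σ i))) t =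
      mulAutArrow (G := Perm X) (M := ℤˣ) (permPart ψ σ)
        (mulAutArrow (G := Perm X) (M := ℤˣ) (permPart ψ (swap x i)) t) := by
    intro i
    -- This permutation fixes x, so its image fixes t; hence σ carries the i-th translate of t to
    -- the σ(i)-th.
    have h := ht ((swap x (σ i))⁻¹ * σ * swap x i) (by simp)
    conv_lhs => rw [← h]
    simp only [← MulAut.mul_apply, ← map_mul]
    congr 3
    group
  funext j
  rw [mulAutArrow_perm_apply]
  change (∏ i, if mulAutArrow (G := Perm X) (M := ℤˣ) (permPart ψ (swap x i)) t j = -1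
    then v (σ⁻¹ i) else 1) = ∏ i, if mulAutArrow (G := Perm X) (M := ℤˣ)
      (permPart ψ (swap x i)) t ((permPart ψ σ)⁻¹ j) = -1 then v i else 1
  rw [← Equiv.prod_comp σ]
  refine Finset.prod_congr rfl fun i _ => ?_
  rw [key, mulAutArrow_perm_apply, ← Perm.mul_apply, inv_mul_cancel, Perm.one_apply]

/-- The homomorphism that extends `ψ` and maps the sign change at `x` to `t`. -/
def extend (ψ : Perm X →* SignedPerm X) {x : X} {t : X → ℤˣ} (ht : Invariant ψ x t) :
    SignedPerm X →* SignedPerm X :=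
  SemidirectProduct.lift (inl.comp (extendSign ψ x t)) ψ fun σ => by
    ext1 v
    simp only [MonoidHom.comp_apply, MulEquiv.coe_toMonoidHom, MulAut.conj_apply]
    rw [extendSign_equivariant ht, conj_inl]
    rfl

theorem invariant_left_map_flip (hX : 5 ≤ Nat.card X) (h : ¬ KillsAlternating φ) (x : X) :
    Invariant (φ.comp inr) x (φ (flip x)).left := by
  intro σ hσ
  have h1 := congrArg φ (inr_mul_flip_mul_inr_inv σ x)
  rw [hσ, map_mul, map_mul, map_inv, flip, map_inl_eq hX h, conj_inl] at h1
  exact inl_injective h1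

/-- The endomorphisms that agree with `φ` on the permutations correspond to the invariant
sign vectors. -/
def fiberEquiv (hX : 5 ≤ Nat.card X) (h : ¬ KillsAlternating φ) (x : X) :
    {χ : SignedPerm X →* SignedPerm X // χ.comp inr = φ.comp inr} ≃
      {t : X → ℤˣ // Invariant (φ.comp inr) x t} where
  toFun χ := ⟨(χ.1 (flip x)).left, by
    have := invariant_left_map_flip (φ := χ.1) hX (fun hχ => h fun σ hσ => ?_) x
    · rwa [χ.2] at this
    · rw [← hχ σ hσ]
      exact (DFunLike.congr_fun χ.2 σ).symm⟩
  invFun t := ⟨extend (φ.comp inr) t.2, by simp [extend]⟩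
  left_inv χ := by
    have hχ : ¬ KillsAlternating χ.1 := by
      refine fun hχ => h fun σ hσ => ?_
      rw [← hχ σ hσ]
      exact (DFunLike.congr_fun χ.2 σ).symm
    refine Subtype.ext (hom_ext x ?_ ?_)
    · simp [extend, χ.2]
    · simp only [extend, flip, lift_inl, MonoidHom.comp_apply, extendSign_mulSingle]
      exact (map_inl_eq hX hχ _).symm
  right_inv t := by
    apply Subtype.ext
    simp [extend, flip, extendSign_mulSingle]

/-- The image of the stabilizer of x is the full stabilizer of a set O, whose orbits are O and its
complement. An invariant vector is a free choice of sign on each. -/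
theorem card_invariant (hX : 7 ≤ Nat.card X) (h : ¬ KillsAlternating φ) (x : X) :
    Nat.card {t : X → ℤˣ // Invariant (φ.comp inr) x t} = 4 := by
  classical
  let α : Perm X ≃* Perm X :=
    MulEquiv.ofBijective (permPart (φ.comp inr)) (permPart_bijective (by omega) h)
  obtain ⟨O, ⟨a, ha⟩, ⟨b, hb⟩, hO⟩ := exists_map_stabilizer_eq hX α x
  have hinv : ∀ t, Invariant (φ.comp inr) x t ↔ ∀ i j, (i ∈ O ↔ j ∈ O) → t i = t j := by
    intro t
    constructor
    · intro ht i j hij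
      have hmem : swap i j ∈ stabilizer (Perm X) O := by
        rw [mem_stabilizer_set_iff_subset_smul_set (Set.toFinite O)]
        intro k hk
        rw [Set.mem_smul_set_iff_inv_smul_mem, swap_inv, Perm.smul_def]
        rcases eq_or_ne k i with rfl | hki
        · rw [swap_apply_left]; exact hij.1 hk
        rcases eq_or_ne k j with rfl | hkj
        · rw [swap_apply_right]; exact hij.2 hk
        rwa [swap_apply_of_ne_of_ne hki hkj]
      rw [← hO] at hmem
      obtain ⟨σ, hσ, hs⟩ := hmem
      have := congrFun (ht σ hσ) j
      rw [mulAutArrow_perm_apply] at this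
      change t ((α.toMonoidHom σ)⁻¹ j) = t j at this
      rwa [hs, swap_inv, swap_apply_right] at this
    · intro ht σ hσ
      funext j
      rw [mulAutArrow_perm_apply]
      apply ht
      have hmem : α σ ∈ stabilizer (Perm X) O := by
        rw [← hO]; exact ⟨σ, hσ, rfl⟩
      have h2 : (α σ) • O = O := hmem
      change (α σ)⁻¹ • j ∈ O ↔ j ∈ O
      rw [← Set.mem_smul_set_iff_inv_smul_mem, h2]
  let e : {t : X → ℤˣ // Invariant (φ.comp inr) x t} ≃ ℤˣ × ℤˣ :=
    { toFun := fun t => (t.1 a, t.1 b)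
      invFun := fun u => ⟨fun i => if i ∈ O then u.1 else u.2, by
        rw [hinv]
        intro i j hij
        simp [hij]⟩
      left_inv := by
        rintro ⟨t, ht⟩
        rw [hinv] at ht
        ext1
        funext i
        dsimp only
        split_ifs with hi
        · exact ht _ _ (by simp [ha, hi])
        · exact ht _ _ (by simpa [hi] using hb)
      right_inv := by
        rintro ⟨u, w⟩
        have : b ∉ O := hb
        simp [ha, this] }
  rw [Nat.card_congr e]
  simp

end NotKills

end SignedPerm

/-! ### Comparing the numbers of endomorphisms -/

namespace SignedPerm

variable {X : Type*} [DecidableEq X]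

theorem mulSingle_neg_one_injective : Function.Injective
    (fun i : X => (Pi.mulSingle i (-1) : X → ℤˣ)) := by
  intro i j h
  by_contra hij
  have := congrFun h i
  simp only [Pi.mulSingle_eq_same, Pi.mulSingle_eq_of_ne hij] at this
  exact absurd this (by decide)

instance {X : Type*} [Finite X] : Finite (SignedPerm X →* SignedPerm X) :=
  Finite.of_injective _ DFunLike.coe_injective

variable [Fintype X]

/-- Every homomorphism from the permutations that is not trivial on even permutations extends in
four ways, one of which kills the sign changes. -/
theorem four_mul_card_not_killsAlternating (hX : 7 ≤ Nat.card X) (x : X) :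
    4 * Nat.card {φ : SignedPerm X →* SignedPerm X // ¬ KillsAlternating φ ∧ φ (flip x) = 1} =
      Nat.card {φ : SignedPerm X →* SignedPerm X // ¬ KillsAlternating φ} := by
  classical
  -- Keep the restriction to permutations and make the sign vectors trivial. The fibres are the sets
  -- of endomorphisms with a common restriction, each of size four.
  let f : {φ : SignedPerm X →* SignedPerm X // ¬ KillsAlternating φ} →
      {φ : SignedPerm X →* SignedPerm X // ¬ KillsAlternating φ ∧ φ (flip x) = 1} := fun φ =>
    ⟨(φ.1.comp inr).comp rightHom, fun h => φ.2 fun σ hσ => by simpa using h σ hσ,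
      by simp [flip]⟩
  have hf : ∀ y φ, f φ = y ↔ φ.1.comp inr = y.1.comp inr := by
    intro y φ
    constructor
    · rintro rfl
      ext1 σ
      simp [f]
    · intro h
      refine Subtype.ext (hom_ext x ?_ ?_)
      · rw [← h]
        ext1 σ
        simp [f]
      · rw [y.2.2]
        simp [f, flip]
  have hfib : ∀ y, Nat.card {φ // f φ = y} = 4 := by
    intro y
    rw [← card_invariant hX y.2.1 x, ← Nat.card_congr (fiberEquiv (by omega) y.2.1 x)]
    refine Nat.card_congr
      { toFun := fun φ => ⟨φ.1.1, (hf y φ.1).1 φ.2⟩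
        invFun := fun χ => ⟨⟨χ.1, fun hχ => y.2.1 fun σ hσ => ?_⟩, (hf y _).2 χ.2⟩
        left_inv := fun φ => rfl
        right_inv := fun χ => rfl }
    exact (DFunLike.congr_fun χ.2 σ).symm.trans (hχ σ hσ)
  have := Fintype.ofFinite
    {φ : SignedPerm X →* SignedPerm X // ¬ KillsAlternating φ ∧ φ (flip x) = 1}
  rw [← Nat.card_congr (Equiv.sigmaFiberEquiv f), Nat.card_sigma]
  simp [hfib, mul_comm]

/-- Conjugations by permutations are injective, hence nontrivial on Aₙ, and are told apart by their
action on sign changes. -/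
theorem factorial_le_card_not_killsAlternating (hX : 3 ≤ Nat.card X) :
    (Nat.card X).factorial ≤
      Nat.card {φ : SignedPerm X →* SignedPerm X // ¬ KillsAlternating φ} := by
  rw [← Nat.card_perm]
  refine Nat.card_le_card_of_injective
    (fun σ => ⟨(MulAut.conj (inr σ : SignedPerm X)).toMonoidHom, fun h => ?_⟩) ?_
  · have := alternatingGroup.nontrivial_of_three_le_card (α := X) hX
    refine (Subgroup.nontrivial_iff_ne_bot _).1 this ((Subgroup.eq_bot_iff_forall _).2 ?_)
    intro τ hτ
    have := h τ hτ
    rw [MulEquiv.coe_toMonoidHom, EmbeddingLike.map_eq_one_iff] at this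
    exact inr_injective (this.trans (map_one _).symm)
  · intro σ τ h
    ext1 i
    have h1 := DFunLike.congr_fun (congrArg Subtype.val h) (flip i)
    simp only [MulEquiv.coe_toMonoidHom, MulAut.conj_apply, inr_mul_flip_mul_inr_inv] at h1
    exact mulSingle_neg_one_injective (inl_injective h1)

theorem card_end_eq :
    Nat.card (SignedPerm X →* SignedPerm X) =
      Nat.card {φ : SignedPerm X →* SignedPerm X // KillsAlternating φ} +
      Nat.card {φ : SignedPerm X →* SignedPerm X // ¬ KillsAlternating φ} := by
  classical
  rw [← Nat.card_sum]
  exact (Nat.card_congr (Equiv.sumCompl _)).symm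

theorem card_killsSwap_le {x y : X} (hxy : x ≠ y) :
    Nat.card {φ : SignedPerm X →* SignedPerm X // inr (swap x y) ∈ φ.ker} ≤
      Nat.card {φ : SignedPerm X →* SignedPerm X // KillsAlternating φ} :=
  Nat.card_le_card_of_injective
    (fun φ => ⟨φ.1, killsAlternating_of_swap hxy φ.2⟩)
    fun _ _ h => Subtype.ext (Subtype.mk.inj h)

theorem card_killsFlip_eq (x : X) :
    Nat.card {φ : SignedPerm X →* SignedPerm X // flip x ∈ φ.ker} =
      Nat.card {φ : SignedPerm X →* SignedPerm X // KillsAlternating φ ∧ φ (flip x) = 1} +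
      Nat.card {φ : SignedPerm X →* SignedPerm X // ¬ KillsAlternating φ ∧ φ (flip x) = 1} := by
  classical
  simp only [MonoidHom.mem_ker]
  rw [← Nat.card_congr (Equiv.sumCompl
    fun φ : {φ : SignedPerm X →* SignedPerm X // φ (flip x) = 1} => KillsAlternating φ.1),
    Nat.card_sum]
  congr 1
  · exact Nat.card_congr ((Equiv.subtypeSubtypeEquivSubtypeInter _ _).trans
      (Equiv.subtypeEquivRight fun _ => and_comm))
  · exact Nat.card_congr ((Equiv.subtypeSubtypeEquivSubtypeInter _ fun φ => ¬ KillsAlternating φ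
      ).trans (Equiv.subtypeEquivRight fun _ => and_comm))

theorem card_killsAlternating_and_le (x : X) :
    Nat.card {φ : SignedPerm X →* SignedPerm X // KillsAlternating φ ∧ φ (flip x) = 1} ≤
      Nat.card {φ : SignedPerm X →* SignedPerm X // KillsAlternating φ} :=
  Nat.card_le_card_of_injective (fun φ => ⟨φ.1, φ.2.1⟩)
    fun _ _ h => Subtype.ext (Subtype.mk.inj h)

theorem tendsto_card_killsAlternating_div :
    Tendsto (fun n : ℕ =>
      (Nat.card {φ : SignedPerm (Fin n) →* SignedPerm (Fin n) // KillsAlternating φ} : ℝ) /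
        (Nat.card (SignedPerm (Fin n) →* SignedPerm (Fin n)) : ℝ)) atTop (𝓝 0) := by
  refine squeeze_zero' (Eventually.of_forall fun n => by positivity) ?_
    (tendsto_pow_mul_pow_div_factorial 512)
  filter_upwards [eventually_ge_atTop 3] with n hn
  have h1 := card_killsAlternating_le hn
  have h2 := factorial_le_card_not_killsAlternating (X := Fin n) (by simpa using hn)
  rw [Nat.card_fin] at h2
  have h3 := card_end_eq (X := Fin n)
  have h4 : n.factorial ≤ Nat.card (SignedPerm (Fin n) →* SignedPerm (Fin n)) := by omega
  have h5 : (0 : ℝ) < n.factorial := by exact_mod_cast n.factorial_pos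
  gcongr

end SignedPerm

/-! ### Limits of the kernel probabilities -/

theorem probMemKer_eq_of_isConj {G : Type} [Group G] [Finite G] {g h : G} (hgh : IsConj g h) :
    probMemKer G g = probMemKer G h := by
  obtain ⟨c, rfl⟩ := isConj_iff.1 hgh
  unfold probMemKer
  congr 2
  refine Nat.card_congr (Equiv.subtypeEquivRight fun φ => ?_)
  simp [MonoidHom.mem_ker]

theorem probMemKer_mulEquiv {G H : Type} [Group G] [Finite G] [Group H] [Finite H] (e : G ≃* H)
    (g : G) : probMemKer G g = probMemKer H (e g) := by
  let E : (G →* G) ≃ (H →* H) :=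
    { toFun := fun φ => e.toMonoidHom.comp (φ.comp e.symm.toMonoidHom)
      invFun := fun φ => e.symm.toMonoidHom.comp (φ.comp e.toMonoidHom)
      left_inv := fun φ => by ext; simp
      right_inv := fun φ => by ext; simp }
  unfold probMemKer
  congr 2
  · refine Nat.card_congr (E.subtypeEquiv fun φ => ?_)
    simp [E, MonoidHom.mem_ker]
  · exact Nat.card_congr E

theorem tendsto_probMemKer_swap (x y : ∀ n : ℕ, 2 ≤ n → Fin n) (hxy : ∀ n h, x n h ≠ y n h) :
    -- The value 0 for small n only makes the sequence total; it does not affect the limit.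
    Tendsto (fun n : ℕ => if h : 2 ≤ n then
      probMemKer (SignedPerm (Fin n)) (inr (swap (x n h) (y n h))) else 0)
      atTop (𝓝 0) := by
  refine squeeze_zero' (Eventually.of_forall fun n => ?_) ?_
    SignedPerm.tendsto_card_killsAlternating_div
  · split_ifs
    · unfold probMemKer; positivity
    · rfl
  · filter_upwards [eventually_ge_atTop 2] with n hn
    rw [dif_pos hn]
    have := SignedPerm.card_killsSwap_le (hxy n hn)
    unfold probMemKer
    gcongr

theorem tendsto_probMemKer_flip (x : ∀ n : ℕ, 1 ≤ n → Fin n) :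
    Tendsto (fun n : ℕ => if h : 1 ≤ n then
      probMemKer (SignedPerm (Fin n)) (SignedPerm.flip (x n h)) else 0)
      atTop (𝓝 (1 / 4)) := by
  rw [tendsto_iff_norm_sub_tendsto_zero]
  refine squeeze_zero' (Eventually.of_forall fun n => norm_nonneg _) ?_
    SignedPerm.tendsto_card_killsAlternating_div
  filter_upwards [eventually_ge_atTop 7] with n hn
  have hn' : 1 ≤ n := by omega
  rw [dif_pos hn']
  have h1 := SignedPerm.card_killsFlip_eq (X := Fin n) (x n hn')
  have h2 := SignedPerm.card_end_eq (X := Fin n)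
  have h3 := SignedPerm.four_mul_card_not_killsAlternating (X := Fin n) (by simpa using hn)
    (x n hn')
  have h4 := SignedPerm.card_killsAlternating_and_le (X := Fin n) (x n hn')
  unfold probMemKer
  rw [h1]
  rw [← h3] at h2
  have hpos : 0 < Nat.card (SignedPerm (Fin n) →* SignedPerm (Fin n)) := Nat.card_pos
  generalize Nat.card (SignedPerm (Fin n) →* SignedPerm (Fin n)) = T at *
  generalize Nat.card {φ : SignedPerm (Fin n) →* SignedPerm (Fin n) //
    ¬ SignedPerm.KillsAlternating φ ∧ φ (SignedPerm.flip (x n hn')) = 1} = k at *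
  generalize Nat.card {φ : SignedPerm (Fin n) →* SignedPerm (Fin n) //
    SignedPerm.KillsAlternating φ ∧ φ (SignedPerm.flip (x n hn')) = 1} = b at *
  generalize Nat.card {φ : SignedPerm (Fin n) →* SignedPerm (Fin n) //
    SignedPerm.KillsAlternating φ} = a at *
  have hT : (0 : ℝ) < T := by exact_mod_cast hpos
  have h2' : (T : ℝ) = a + 4 * k := by exact_mod_cast h2
  have h4' : (b : ℝ) ≤ a := by exact_mod_cast h4
  have hb : (0 : ℝ) ≤ b := by positivity
  -- Since T = a + 4k, the k terms cancel, and 0 ≤ b ≤ a bounds the deviation by a / T, which tends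
  -- to 0.
  have e : ((b + k : ℕ) : ℝ) / T - 1 / 4 = (b - a / 4) / T := by
    push_cast
    field_simp
    linarith
  rw [e, norm_div, Real.norm_of_nonneg hT.le]
  gcongr
  rw [Real.norm_eq_abs, abs_le]
  constructor <;> linarith

/-! ### Signed permutations as symmetries of the cube -/

namespace SignedPerm

variable {n : ℕ}

theorem units_cast_mul_self (u : ℤˣ) : ((u : ℤ) : ℝ) * ((u : ℤ) : ℝ) = 1 := by
  rcases Int.units_eq_one_or u with rfl | rfl <;> simp

/-- The linear isometry that permutes the coordinates and changes signs. -/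
noncomputable def toIsometry (g : SignedPerm (Fin n)) :
    EuclideanSpace ℝ (Fin n) ≃ₗᵢ[ℝ] EuclideanSpace ℝ (Fin n) where
  toFun x := WithLp.toLp 2 fun i => ((g.left i : ℤ) : ℝ) * x (g.right⁻¹ i)
  invFun x := WithLp.toLp 2 fun i => ((g.left (g.right i) : ℤ) : ℝ) * x (g.right i)
  map_add' x y := by ext i; simp [mul_add]
  map_smul' c x := by ext i; simp [mul_left_comm]
  left_inv x := by
    ext i
    simp [← mul_assoc, units_cast_mul_self]
  right_inv x := by
    ext i
    simp [← mul_assoc, units_cast_mul_self]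
  norm_map' x := by
    simp only [LinearEquiv.coe_mk, LinearMap.coe_mk, AddHom.coe_mk, EuclideanSpace.norm_eq,
      norm_mul, mul_pow]
    have h : ∀ u : ℤˣ, ‖((u : ℤ) : ℝ)‖ ^ 2 = 1 := fun u => by
      rcases Int.units_eq_one_or u with rfl | rfl <;> simp
    simp only [h, one_mul]
    rw [Equiv.sum_comp g.right⁻¹ fun i => ‖x i‖ ^ 2]

theorem toIsometry_apply (g : SignedPerm (Fin n)) (x : EuclideanSpace ℝ (Fin n)) (i : Fin n) :
    toIsometry g x i = ((g.left i : ℤ) : ℝ) * x (g.right⁻¹ i) := rfl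

theorem toIsometry_single (g : SignedPerm (Fin n)) (i : Fin n) :
    toIsometry g (EuclideanSpace.single i (1 : ℝ)) =
      ((g.left (g.right i) : ℤ) : ℝ) • EuclideanSpace.single (g.right i) (1 : ℝ) := by
  ext j
  rw [toIsometry_apply]
  by_cases h : j = g.right i
  · subst h; simp
  · have : g.right⁻¹ j ≠ i := fun h' => h (by simp [← h'])
    simp only [PiLp.smul_apply, PiLp.single_apply, if_neg h, if_neg this, smul_zero,
      mul_zero]

theorem units_smul_single_mem (u : ℤˣ) (i : Fin n) :
    ((u : ℤ) : ℝ) • EuclideanSpace.single i (1 : ℝ) ∈ signedBasis n := by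
  rcases Int.units_eq_one_or u with rfl | rfl
  · exact ⟨i, Or.inl (by simp)⟩
  · exact ⟨i, Or.inr (by simp)⟩

theorem exists_of_mem_signedBasis {x : EuclideanSpace ℝ (Fin n)} (hx : x ∈ signedBasis n) :
    ∃ (i : Fin n) (u : ℤˣ), x = ((u : ℤ) : ℝ) • EuclideanSpace.single i (1 : ℝ) := by
  obtain ⟨i, rfl | rfl⟩ := hx
  · exact ⟨i, 1, by simp⟩
  · exact ⟨i, -1, by simp⟩

/-- Signed permutations act as symmetries of the cube. -/
noncomputable def toHyperoctahedral (n : ℕ) : SignedPerm (Fin n) →* hyperoctahedral n where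
  toFun g := ⟨toIsometry g, mem_hyperoctahedral_of_single fun i => by
    rw [toIsometry_single]; exact units_smul_single_mem _ _⟩
  map_one' := by
    ext x i
    change toIsometry 1 x i = x i
    rw [toIsometry_apply, one_left, one_right, inv_one, Perm.one_apply, Pi.one_apply,
      Units.val_one, Int.cast_one, one_mul]
  map_mul' g h := by
    ext x i
    change toIsometry (g * h) x i = toIsometry g (toIsometry h x) i
    simp only [toIsometry_apply, mul_left, mul_right, Pi.mul_apply, mulAutArrow_perm_apply,
      mul_inv_rev, Perm.mul_apply, Units.val_mul, Int.cast_mul, mul_assoc]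

theorem isometry_ext {w w' : EuclideanSpace ℝ (Fin n) ≃ₗᵢ[ℝ] EuclideanSpace ℝ (Fin n)}
    (h : ∀ i, w (EuclideanSpace.single i (1 : ℝ)) = w' (EuclideanSpace.single i (1 : ℝ))) :
    w = w' := by
  apply LinearIsometryEquiv.toLinearEquiv_injective
  refine (EuclideanSpace.basisFun (Fin n) ℝ).toBasis.ext' fun i => ?_
  simpa using h i

theorem toHyperoctahedral_injective : Function.Injective (toHyperoctahedral n) := by
  intro g h hgh
  have hx : ∀ i j, toIsometry g (EuclideanSpace.single i (1 : ℝ)) j =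
      toIsometry h (EuclideanSpace.single i (1 : ℝ)) j := fun i j => by
    rw [show toIsometry g = toIsometry h from congrArg Subtype.val hgh]
  have hr : ∀ i, g.right i = h.right i := by
    intro i
    by_contra hne
    have := hx i (g.right i)
    rw [toIsometry_single, toIsometry_single] at this
    simp [hne] at this
  refine SemidirectProduct.ext ?_ (Equiv.ext hr)
  funext j
  have := hx (g.right⁻¹ j) j
  rw [toIsometry_single, toIsometry_single, ← hr] at this
  simpa [Units.ext_iff] using this

theorem toHyperoctahedral_surjective : Function.Surjective (toHyperoctahedral n) := by
  rintro ⟨w, hw⟩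
  have hw' : ∀ i, ∃ (j : Fin n) (u : ℤˣ), w (EuclideanSpace.single i (1 : ℝ)) =
      ((u : ℤ) : ℝ) • EuclideanSpace.single j (1 : ℝ) := fun i =>
    exists_of_mem_signedBasis <| by
      rw [← show w '' signedBasis n = signedBasis n from hw]
      exact Set.mem_image_of_mem _ ⟨i, Or.inl rfl⟩
  choose j u hju using hw'
  -- Two basis vectors sent to the same axis would have images with inner product ±1 instead of 0.
  have hj : Function.Injective j := by
    intro i k hik
    by_contra hne
    have h1 : inner ℝ (w (EuclideanSpace.single i (1 : ℝ)))
        (w (EuclideanSpace.single k (1 : ℝ))) = 0 := by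
      rw [LinearIsometryEquiv.inner_map_map]
      simp [EuclideanSpace.inner_single_left, hne]
    rw [hju, hju, hik, inner_smul_left, inner_smul_right] at h1
    simp at h1
  let σ : Perm (Fin n) := Equiv.ofBijective j (Finite.injective_iff_bijective.1 hj)
  refine ⟨⟨fun k => u (σ⁻¹ k), σ⟩, Subtype.ext (isometry_ext fun i => ?_)⟩
  rw [hju]
  change toIsometry _ _ = _
  rw [toIsometry_single]
  change ((u (σ⁻¹ (σ i)) : ℤ) : ℝ) • _ = _
  rw [← Perm.mul_apply, inv_mul_cancel]
  rfl

/-- The symmetry group of the cube is the group of signed permutations. -/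
noncomputable def equivHyperoctahedral (n : ℕ) : SignedPerm (Fin n) ≃* hyperoctahedral n :=
  MulEquiv.ofBijective (toHyperoctahedral n)
    ⟨toHyperoctahedral_injective, toHyperoctahedral_surjective⟩

theorem equivHyperoctahedral_flip (i : Fin n) :
    equivHyperoctahedral n (flip i) = invertReflection i := by
  refine Subtype.ext (isometry_ext fun k => ?_)
  change toIsometry (flip i) _ = rootReflection _ _
  rw [toIsometry_single]
  simp only [flip, left_inl, right_inl, Perm.one_apply]
  by_cases hk : k = i
  · subst hk
    rw [Pi.mulSingle_eq_same, rootReflection,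
      Submodule.reflection_orthogonalComplement_singleton_eq_neg]
    rw [Units.val_neg, Units.val_one]
    simp only [Int.cast_neg, Int.cast_one, neg_smul, one_smul]
  · rw [Pi.mulSingle_eq_of_ne hk, Units.val_one, Int.cast_one, one_smul]
    refine (Submodule.reflection_mem_subspace_eq_self ?_).symm
    rw [Submodule.mem_orthogonal_singleton_iff_inner_right]
    simp [EuclideanSpace.inner_single_left, Ne.symm hk]

theorem equivHyperoctahedral_swap (i j : Fin n) :
    equivHyperoctahedral n (inr (swap i j)) = permuteReflection i j := by
  refine Subtype.ext (isometry_ext fun k => ?_)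
  change toIsometry (inr (swap i j)) _ = rootReflection _ _
  rw [toIsometry_single]
  simp only [left_inr, right_inr, Pi.one_apply, Units.val_one, Int.cast_one, one_smul]
  by_cases hi : k = i
  · rw [hi, swap_apply_left]
    exact (rootReflection_sub_single i j).symm
  by_cases hj : k = j
  · have h := congrArg (rootReflection (EuclideanSpace.single i (1 : ℝ) -
      EuclideanSpace.single j (1 : ℝ))) (rootReflection_sub_single i j)
    rw [rootReflection_rootReflection] at h
    rw [hj, swap_apply_right]
    exact h
  · rw [swap_apply_of_ne_of_ne hi hj]
    refine (Submodule.reflection_mem_subspace_eq_self ?_).symm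
    rw [Submodule.mem_orthogonal_singleton_iff_inner_right]
    simp [inner_sub_left, EuclideanSpace.inner_single_left, Ne.symm hi, Ne.symm hj]

end SignedPerm

end SignedPermutations

theorem mainTheorem8 :
    (∀ r : (n : ℕ) → hyperoctahedral n,
      (∀ (n : ℕ) (hn : 2 ≤ n), IsConj (r n)
        (permuteReflection (⟨0, by omega⟩ : Fin n) (⟨1, by omega⟩ : Fin n))) →
      Tendsto (fun n : ℕ => probMemKer (hyperoctahedral n) (r n)) atTop (𝓝 0)) ∧
    (∀ r : (n : ℕ) → hyperoctahedral n,
      (∀ (n : ℕ) (hn : 1 ≤ n), IsConj (r n) (invertReflection (⟨0, by omega⟩ : Fin n))) →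
      Tendsto (fun n : ℕ => probMemKer (hyperoctahedral n) (r n)) atTop (𝓝 (1 / 4))) := by
  constructor
  · intro r hr
    refine (tendsto_probMemKer_swap (fun n h => ⟨0, by omega⟩) (fun n h => ⟨1, by omega⟩)
      (by simp)).congr' ?_
    filter_upwards [eventually_ge_atTop 2] with n hn
    rw [dif_pos hn, probMemKer_eq_of_isConj (hr n hn), ← SignedPerm.equivHyperoctahedral_swap,
      ← probMemKer_mulEquiv]
  · intro r hr
    refine (tendsto_probMemKer_flip fun n h => ⟨0, by omega⟩).congr' ?_
    filter_upwards [eventually_ge_atTop 1] with n hn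
    rw [dif_pos hn, probMemKer_eq_of_isConj (hr n hn), ← SignedPerm.equivHyperoctahedral_flip,
      ← probMemKer_mulEquiv]
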